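/- Call an infinite cardinal $\kappa$ measurable if there is a nonprincipal ultrafilter on a set of cardinality $\kappa$ that is $\kappa$-complete, i.e., closed under intersections of families of fewer than $\kappa$ members (so $\aleph_0$ counts as measurable). Let $k$ be an algebraically closed field of characteristic $0$, let $(A_i)_{i\in I}$ be a family of finite-dimensional simple Lie algebras over $k$, suppose that $\mathrm{card}(I)$ is less than every measurable cardinal $>\mathrm{card}(k)$ (a condition that holds vacuously if there are no such cardinals), and let $f:\prod_{i\in I}A_i\to B$ be a surjective homomorphism of Lie algebras over $k$ onto a finite-dimensional Lie algebra $B$ over $k$. Then $B$ is semisimple (the zero algebra being counted as semisimple), and there are a finite subset $\{i_1,\dots,i_n\}\subseteq I$ (possibly empty) with $i_1,\dots,i_n$ distinct and an isomorphism $e:A_{i_1}\times\dots\times A_{i_n}\to B$ of Lie algebras over $k$ such that $f=e\circ\pi$, where $\pi:\prod_{i\in I}A_i\to A_{i_1}\times\dots\times A_{i_n}$ is the projection. In particular, $f$ splits: there is a homomorphism of Lie algebras $g:B\to\prod_{i\in I}A_i$ over $k$ with $f\circ g=\mathrm{id}_B$. -/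

import Mathlib

universe u v w x

open scoped Cardinal

/-- The direct product of a family of Lie rings, with the componentwise bracket. -/
instance piLieRing {I : Type v} (A : I → Type w) [∀ i, LieRing (A i)] : LieRing (∀ i, A i) where
  bracket a b := fun i => ⁅a i, b i⁆
  add_lie a b c := funext fun i => add_lie (a i) (b i) (c i)
  lie_add a b c := funext fun i => lie_add (a i) (b i) (c i)
  lie_self a := funext fun i => lie_self (a i)
  leibniz_lie a b c := funext fun i => leibniz_lie (a i) (b i) (c i)

/-- The direct product of a family of Lie algebras, with the componentwise operations. -/
instance piLieAlgebra (k : Type u) [CommRing k] {I : Type v} (A : I → Type w)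
    [∀ i, LieRing (A i)] [∀ i, LieAlgebra k (A i)] : LieAlgebra k (∀ i, A i) where
  lie_smul t a b := funext fun i => lie_smul t (a i) (b i)

/-- The projection of a direct product of Lie algebras onto the subproduct indexed by `s`. -/
def subproductProj (k : Type u) [CommRing k] {I : Type v} (A : I → Type w)
    [∀ i, LieRing (A i)] [∀ i, LieAlgebra k (A i)] (s : Finset I) :
    (∀ i, A i) →ₗ⁅k⁆ (∀ i : s, A i) where
  toFun a := fun i => a i
  map_add' _ _ := rfl
  map_smul' _ _ := rfl
  map_lie' := rfl

/-- An infinite cardinal `κ` is *measurable* if there is a nonprincipal `κ`-complete ultrafilter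
on a set of cardinality `κ`, where `κ`-complete means closed under intersections of families of
fewer than `κ` members. With this convention `ℵ₀` is measurable. -/
def IsMeasurableCardinal (κ : Cardinal.{u}) : Prop :=
  ℵ₀ ≤ κ ∧ ∃ U : Ultrafilter κ.out,
    (∀ x : κ.out, U ≠ pure x) ∧ CardinalInterFilter (U : Filter κ.out) κ

/-! Every element of a simple factor is a sum of two brackets; the bound is uniform, so it passes to
the infinite product. Elements with disjoint supports commute, hence disjoint parts of the product
whose images are comparable under inclusion cannot both matter, and finite-dimensionality of `B`
leaves only finitely many factors with nonzero image. If the rest of the product still had nonzero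
image, a part of least nonzero image dimension would define a nonprincipal ultrafilter
(`exists_ultrafilter_of_imageOn_ne_bot`). A polynomial trick shows that every map `I → k` has a
fiber in it, which forces a measurable cardinal above `#k` and at most `#I`. So `f` factors through
finitely many simple factors, and its kernel there is a subproduct. -/

/-! ### Sums of two brackets in Killing Lie algebras -/

open LieAlgebra LieModule in
/-- In a Lie algebra with nonsingular Killing form over an algebraically closed field of
characteristic zero, some two elements have trivial common centralizer. -/
theorem exists_pair_common_centralizer_trivial (k : Type u) [Field k] [IsAlgClosed k] [CharZero k]
    (L : Type w) [LieRing L] [LieAlgebra k L] [FiniteDimensional k L] [IsKilling k L] :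
    ∃ x₁ x₂ : L, ∀ z : L, ⁅z, x₁⁆ = 0 → ⁅z, x₂⁆ = 0 → z = 0 := by
  have : Infinite k := IsAlgClosed.instInfinite
  obtain ⟨x₁, hx₁⟩ := exists_isCartanSubalgebra_engel k L
  set H := LieSubalgebra.engel k x₁
  choose e he using fun α : Weight k H L => α.exists_ne_zero
  refine ⟨x₁, ∑ α, e α, fun z h₁ h₂ => ?_⟩
  -- The Engel subalgebra of `x₁` contains its centralizer. Bracketing `z` with a sum of independent
  -- weight vectors then forces every weight to vanish at `z`, and the weights separate points of
  -- `H`.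
  have hzH : z ∈ H := by
    rw [LieSubalgebra.mem_engel_iff]
    exact ⟨1, by rw [pow_one, ad_apply, ← lie_skew, h₁, neg_zero]⟩
  have hsum : ∑ α : Weight k H L, α ⟨z, hzH⟩ • e α = 0 := by
    rw [← h₂, lie_sum]
    exact Finset.sum_congr rfl fun α _ =>
      (IsKilling.lie_eq_smul_of_mem_rootSpace (he α).1 ⟨z, hzH⟩).symm
  have hind : LinearIndependent k e :=
    (LieSubmodule.iSupIndep_toSubmodule.mpr (iSupIndep_genWeightSpace' k H L)).linearIndependent
      _ (fun α => (he α).1) fun α => (he α).2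
  have hα := Fintype.linearIndependent_iff.mp hind _ hsum
  have : (⟨z, hzH⟩ : H) ∈ (⨅ α : Weight k H L, α.ker) := by
    exact (Submodule.mem_iInf _).mpr hα
  rw [IsKilling.iInf_ker_weight_eq_bot] at this
  exact congrArg Subtype.val ((Submodule.mem_bot k).mp this)

open LieAlgebra LieModule in
/-- A Lie algebra `L` with nonsingular Killing form over an algebraically closed field of
characteristic zero is of the form `⁅x₁, L⁆ + ⁅x₂, L⁆`. -/
theorem exists_pair_forall_eq_lie_add_lie (k : Type u) [Field k] [IsAlgClosed k] [CharZero k]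
    (L : Type w) [LieRing L] [LieAlgebra k L] [FiniteDimensional k L] [IsKilling k L] :
    ∃ x₁ x₂ : L, ∀ y : L, ∃ y₁ y₂ : L, y = ⁅x₁, y₁⁆ + ⁅x₂, y₂⁆ := by
  obtain ⟨x₁, x₂, h⟩ := exists_pair_common_centralizer_trivial k L
  refine ⟨x₁, x₂, ?_⟩
  suffices hP : LinearMap.range (ad k L x₁ : L →ₗ[k] L) ⊔ LinearMap.range (ad k L x₂ : L →ₗ[k] L)
      = ⊤ by
    intro y
    obtain ⟨_, ⟨a, rfl⟩, _, ⟨b, rfl⟩, hab⟩ := Submodule.mem_sup.mp (hP ▸ Submodule.mem_top (x := y))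
    exact ⟨a, b, hab.symm⟩
  by_contra hP
  obtain ⟨φ, hφ, hle⟩ := Submodule.exists_le_ker_of_lt_top _ (lt_top_iff_ne_top.mpr hP)
  obtain ⟨z, rfl⟩ :=
    ((killingForm k L).toDual (IsKilling.killingForm_nondegenerate k L)).surjective φ
  -- Invariance of the form: `z` orthogonal to `⁅x, L⁆` commutes with `x`.
  have hz : ∀ x y : L, killingForm k L z ⁅x, y⁆ = 0 → killingForm k L ⁅z, x⁆ y = 0 := by
    intro x y hxy
    rwa [killingForm, traceForm_apply_lie_apply]
  have key : ∀ x : L, (∀ y, killingForm k L z ⁅x, y⁆ = 0) → ⁅z, x⁆ = 0 := by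
    intro x hx
    exact (IsKilling.killingForm_nondegenerate k L).1 _ fun y => hz x y (hx y)
  have hz0 : z = 0 := h z
    (key x₁ fun y => hle (Submodule.mem_sup_left ⟨y, rfl⟩))
    (key x₂ fun y => hle (Submodule.mem_sup_right ⟨y, rfl⟩))
  exact hφ (by rw [hz0, map_zero])

/-! ### Ultrafilters and measurable cardinals -/

/-- Let `U` be a nonprincipal ultrafilter on `X`. The least cardinal `κ` for which there is a map
from `X` to a set of cardinality `κ` with no fiber in `U` is measurable. -/
theorem exists_isMeasurableCardinal_of_ultrafilter {X : Type u} (U : Ultrafilter X)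
    (hU : ∀ x, {x} ∉ U) :
    ∃ κ : Cardinal.{u}, IsMeasurableCardinal κ ∧ κ ≤ #X ∧
      ∃ h : X → κ.out, ∀ y, h ⁻¹' {y} ∉ U := by
  let C : Set Cardinal.{u} := {κ | ∃ Y : Type u, #Y = κ ∧ ∃ h : X → Y, ∀ y, h ⁻¹' {y} ∉ U}
  have hX : #X ∈ C := ⟨X, rfl, id, hU⟩
  have hmin : ∀ (Y : Type u) (h : X → Y), #Y < sInf C → ∃ y, h ⁻¹' {y} ∈ U := by
    intro Y h hlt
    by_contra! hY
    exact notMem_of_lt_csInf' hlt ⟨Y, rfl, h, hY⟩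
  obtain ⟨Y, hY, h', hh'⟩ := csInf_mem ⟨_, hX⟩
  obtain ⟨g⟩ := Cardinal.eq.mp (hY.trans (sInf C).mk_out.symm)
  let h : X → (sInf C).out := g ∘ h'
  have hh : ∀ y, h ⁻¹' {y} ∉ U := fun y => by
    have : h ⁻¹' {y} = h' ⁻¹' {g.symm y} := by
      ext x; simp [h, Equiv.eq_symm_apply]
    rw [this]; exact hh' _
  have hinf : ℵ₀ ≤ sInf C := by
    by_contra! hlt
    have : Finite (sInf C).out := by
      rw [← Cardinal.lt_aleph0_iff_finite, Cardinal.mk_out]; exact hlt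
    have huniv : (⋃ y ∈ (Set.univ : Set (sInf C).out), h ⁻¹' {y}) ∈ U := by
      have : (⋃ y ∈ (Set.univ : Set (sInf C).out), h ⁻¹' {y}) = Set.univ := by ext; simp
      rw [this]; exact Filter.univ_mem
    obtain ⟨y, -, hy⟩ := (Ultrafilter.finite_biUnion_mem_iff Set.finite_univ).mp huniv
    exact hh y hy
  refine ⟨sInf C, ⟨hinf, U.map h, fun y hy => hh y ?_, ⟨fun S hS hmem => ?_⟩⟩,
    csInf_le' hX, h, hh⟩
  · have : {y} ∈ U.map h := by rw [hy]; exact Set.mem_singleton y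
    exact this
  · classical
    by_contra hnot
    -- Send each point to a member of `S` omitting it. By minimality some fiber is large; but the
    -- fiber of `none` lies in the intersection of `S`, and that of `some s` misses `s`.
    let q : (sInf C).out → Option S := fun y =>
      if hy : ∃ s : S, y ∉ (s : Set (sInf C).out) then some hy.choose else none
    have hcard : #(Option S) < sInf C := by
      rw [Cardinal.mk_option]
      exact Cardinal.add_lt_of_lt hinf hS (Cardinal.one_lt_aleph0.trans_le hinf)
    obtain ⟨o, ho⟩ := hmin _ (q ∘ h) hcard
    cases o with
    | none =>
      refine hnot (Filter.mem_of_superset (show q ⁻¹' {none} ∈ U.map h from ho) ?_)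
      intro y hy s hs
      by_contra hys
      have : q y = some _ := dif_pos ⟨⟨s, hs⟩, hys⟩
      exact Option.some_ne_none _ (this.symm.trans hy)
    | some s =>
      have hs : q ⁻¹' {some s} ∈ U.map h := ho
      obtain ⟨y, hy, hys⟩ := (U.map h).nonempty_of_mem (Filter.inter_mem hs (hmem s s.2))
      by_cases hex : ∃ s : S, y ∉ (s : Set (sInf C).out)
      · have : q y = some hex.choose := dif_pos hex
        have h2 : hex.choose = s := Option.some.inj (this.symm.trans hy)
        exact hex.choose_spec (h2 ▸ hys)
      · have : q y = none := dif_neg hex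
        exact Option.some_ne_none s (hy.symm.trans this)

/-- If every map from `I` to `K` has a fiber in the nonprincipal ultrafilter `U` on `I`, then there
is a measurable cardinal that is greater than `#K` and at most `#I`. -/
theorem exists_isMeasurableCardinal_between {K : Type u} {I : Type v} (U : Ultrafilter I)
    (hU : ∀ i, {i} ∉ U) (hK : ∀ t : I → K, ∃ c, t ⁻¹' {c} ∈ U) :
    ∃ μ : Cardinal.{max u v}, IsMeasurableCardinal μ ∧ Cardinal.lift.{v} #K < μ ∧
      μ ≤ Cardinal.lift.{u} #I := by
  obtain ⟨μ, hμ, hle, h, hh⟩ := exists_isMeasurableCardinal_of_ultrafilter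
    (U.map (ULift.up.{u, v})) (fun x hx => hU x.down (by
      refine Filter.mem_of_superset (show ULift.up ⁻¹' {x} ∈ U from hx) ?_
      rintro i rfl; rfl))
  refine ⟨μ, hμ, ?_, by simpa using hle⟩
  by_contra! hlt
  rw [← Cardinal.mk_out μ, ← Cardinal.mk_uLift, Cardinal.le_def] at hlt
  obtain ⟨g⟩ := hlt
  -- As `g` is injective, a large fiber of this map would lie in a fiber of `h`.
  obtain ⟨c, hc⟩ := hK fun i => (g (h ⟨i⟩)).down
  obtain ⟨i, hi⟩ := U.nonempty_of_mem hc
  refine hh (h ⟨i⟩) 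
    (show (fun j => h (ULift.up j)) ⁻¹' {h ⟨i⟩} ∈ U from Filter.mem_of_superset hc fun j hj => ?_)
  exact g.injective (ULift.down_injective (hj.trans hi.symm))

/-! ### Images of the parts of a product -/

section Restriction

variable {k : Type u} [Field k] {I : Type v} {A : I → Type w} [∀ i, LieRing (A i)]
  [∀ i, LieAlgebra k (A i)] {B : Type x} [LieRing B] [LieAlgebra k B]

open Classical in
/-- The endomorphism of a product of Lie algebras that sets the coordinates outside `S` to `0`. -/
noncomputable def restrictTo (k : Type u) [Field k] {I : Type v} (A : I → Type w)
    [∀ i, LieRing (A i)] [∀ i, LieAlgebra k (A i)] (S : Set I) : (∀ i, A i) →ₗ⁅k⁆ (∀ i, A i) where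
  toFun a := fun i => if i ∈ S then a i else 0
  map_add' a b := by ext i; by_cases h : i ∈ S <;> simp [h]
  map_smul' t a := by ext i; by_cases h : i ∈ S <;> simp [h]
  map_lie' {a b} := by
    ext i
    change (if i ∈ S then ⁅a i, b i⁆ else 0) =
      ⁅(if i ∈ S then a i else 0), (if i ∈ S then b i else 0)⁆
    by_cases h : i ∈ S <;> simp [h]

theorem restrictTo_apply_of_mem {S : Set I} {i : I} (h : i ∈ S) (a : ∀ i, A i) :
    restrictTo k A S a i = a i := if_pos h

theorem restrictTo_apply_of_notMem {S : Set I} {i : I} (h : i ∉ S) (a : ∀ i, A i) :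
    restrictTo k A S a i = 0 := if_neg h

theorem restrictTo_restrictTo (S T : Set I) (a : ∀ i, A i) :
    restrictTo k A S (restrictTo k A T a) = restrictTo k A (S ∩ T) a := by
  ext i
  by_cases hS : i ∈ S <;> by_cases hT : i ∈ T <;>
    simp [restrictTo_apply_of_mem, restrictTo_apply_of_notMem, hS, hT]

theorem restrictTo_univ (a : ∀ i, A i) : restrictTo k A Set.univ a = a :=
  funext fun i => restrictTo_apply_of_mem (Set.mem_univ i) a

theorem restrictTo_empty (a : ∀ i, A i) : restrictTo k A ∅ a = 0 :=
  funext fun i => restrictTo_apply_of_notMem (Set.notMem_empty i) a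

theorem restrictTo_eq_add (S T : Set I) (a : ∀ i, A i) :
    restrictTo k A S a = restrictTo k A (S ∩ T) a + restrictTo k A (S ∩ Tᶜ) a := by
  ext i
  by_cases hS : i ∈ S <;> by_cases hT : i ∈ T <;>
    simp [restrictTo_apply_of_mem, restrictTo_apply_of_notMem, hS, hT]

theorem lie_restrictTo_of_disjoint {S T : Set I} (h : Disjoint S T) (a b : ∀ i, A i) :
    ⁅restrictTo k A S a, restrictTo k A T b⁆ = 0 := by
  ext i
  change ⁅restrictTo k A S a i, restrictTo k A T b i⁆ = 0
  by_cases hS : i ∈ S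
  · rw [restrictTo_apply_of_notMem (Set.disjoint_left.mp h hS), lie_zero]
  · rw [restrictTo_apply_of_notMem hS, zero_lie]

/-- The image under `f` of the elements of a product with support in `S`. -/
noncomputable def imageOn (f : (∀ i, A i) →ₗ⁅k⁆ B) (S : Set I) : Submodule k B :=
  LinearMap.range ((f.comp (restrictTo k A S) : (∀ i, A i) →ₗ⁅k⁆ B) : (∀ i, A i) →ₗ[k] B)

variable (f : (∀ i, A i) →ₗ⁅k⁆ B)

theorem mem_imageOn {S : Set I} {b : B} : b ∈ imageOn f S ↔ ∃ a, f (restrictTo k A S a) = b :=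
  Iff.rfl

theorem apply_restrictTo_mem_imageOn (S : Set I) (a : ∀ i, A i) :
    f (restrictTo k A S a) ∈ imageOn f S := ⟨a, rfl⟩

theorem imageOn_eq_bot {S : Set I} : imageOn f S = ⊥ ↔ ∀ a, f (restrictTo k A S a) = 0 := by
  rw [imageOn, LinearMap.range_eq_bot, LinearMap.ext_iff]
  rfl

theorem imageOn_mono {S T : Set I} (h : S ⊆ T) : imageOn f S ≤ imageOn f T := by
  rintro _ ⟨a, rfl⟩
  refine ⟨restrictTo k A S a, ?_⟩
  change f (restrictTo k A T (restrictTo k A S a)) = f (restrictTo k A S a)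
  rw [restrictTo_restrictTo, Set.inter_eq_right.mpr h]

theorem imageOn_le_sup (S T : Set I) : imageOn f S ≤ imageOn f (S ∩ T) ⊔ imageOn f (S ∩ Tᶜ) := by
  rintro _ ⟨a, rfl⟩
  change f (restrictTo k A S a) ∈ _
  rw [restrictTo_eq_add S T, map_add]
  exact Submodule.add_mem_sup ⟨a, rfl⟩ ⟨a, rfl⟩

theorem imageOn_empty : imageOn f ∅ = ⊥ :=
  (imageOn_eq_bot f).mpr fun a => by rw [restrictTo_empty, map_zero]

theorem imageOn_union_eq_bot {S T : Set I} (hS : imageOn f S = ⊥) (hT : imageOn f T = ⊥) :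
    imageOn f (S ∪ T) = ⊥ := by
  rw [eq_bot_iff]
  refine (imageOn_le_sup f _ S).trans (sup_le ?_ ?_)
  · exact hS ▸ imageOn_mono f Set.inter_subset_right
  · refine hT ▸ imageOn_mono f ?_
    rintro i ⟨h | h, hn⟩
    exacts [absurd h hn, h]

theorem imageOn_biUnion_eq_bot {ι : Type*} (s : Finset ι) (S : ι → Set I)
    (h : ∀ j ∈ s, imageOn f (S j) = ⊥) : imageOn f (⋃ j ∈ s, S j) = ⊥ := by
  classical
  induction s using Finset.induction_on with
  | empty => simpa using imageOn_empty f
  | insert j s _ ih =>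
    rw [Finset.set_biUnion_insert]
    exact imageOn_union_eq_bot f (h j (Finset.mem_insert_self j s))
      (ih fun i hi => h i (Finset.mem_insert_of_mem hi))

/-! ### Consequences of the two-bracket property -/

section Perfect

variable (hA : ∀ a : ∀ i, A i, ∃ x₁ x₂ y₁ y₂ : ∀ i, A i, a = ⁅x₁, y₁⁆ + ⁅x₂, y₂⁆)

include hA in
theorem imageOn_eq_bot_of_lie {S : Set I}
    (h : ∀ a b, ⁅f (restrictTo k A S a), f (restrictTo k A S b)⁆ = 0) : imageOn f S = ⊥ := by
  refine (imageOn_eq_bot f).mpr fun a => ?_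
  obtain ⟨x₁, x₂, y₁, y₂, rfl⟩ := hA a
  rw [map_add, map_add, LieHom.map_lie, LieHom.map_lie, LieHom.map_lie, LieHom.map_lie, h, h,
    add_zero]

-- Disjoint supports commute, so the image of `S` is abelian, hence zero.
include hA in
theorem imageOn_eq_bot_of_le_of_disjoint {S T : Set I} (hle : imageOn f S ≤ imageOn f T)
    (h : Disjoint S T) : imageOn f S = ⊥ := by
  refine imageOn_eq_bot_of_lie f hA fun a b => ?_
  obtain ⟨c, hc⟩ := (mem_imageOn f).mp (hle (apply_restrictTo_mem_imageOn f S b))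
  rw [← hc, ← LieHom.map_lie, lie_restrictTo_of_disjoint h, map_zero]

include hA in
/-- All but finitely many factors of the product have image zero. -/
theorem exists_finset_forall_imageOn_singleton_eq_bot [FiniteDimensional k B] :
    ∃ J : Finset I, ∀ j ∉ J, imageOn f {j} = ⊥ := by
  classical
  obtain ⟨J, hJ⟩ := exists_minimal_of_wellFoundedLT (fun n => ∃ J : Finset I,
    Module.finrank k (imageOn f ((J : Set I)ᶜ)) = n) ⟨_, ∅, rfl⟩
  obtain ⟨⟨J, rfl⟩, hmin⟩ := hJ
  refine ⟨J, fun j hj => ?_⟩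
  have hle : imageOn f (((insert j J : Finset I) : Set I)ᶜ) ≤ imageOn f ((J : Set I)ᶜ) :=
    imageOn_mono f (by simp)
  have heq := Submodule.eq_of_le_of_finrank_le hle
    (hmin ⟨insert j J, rfl⟩ (Submodule.finrank_mono hle))
  refine imageOn_eq_bot_of_le_of_disjoint f hA (T := ((insert j J : Finset I) : Set I)ᶜ) ?_ (by simp)
  rw [heq]
  exact imageOn_mono f (by simpa using hj)

/-- The polynomials in `t : I → k`, applied to the element `a` of a product of `k`-modules. -/
noncomputable def polynomialSMul (t : I → k) (a : ∀ i, A i) : Polynomial k →ₗ[k] (∀ i, A i) where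
  toFun p := fun i => p.eval (t i) • a i
  map_add' p q := by ext i; simp [add_smul]
  map_smul' c p := by ext i; simp [mul_smul]

include hA in
/-- If the elements with support in any fiber of `t : I → k` map to zero, so do all elements. -/
theorem imageOn_eq_bot_of_fibers [FiniteDimensional k B] {T : Set I} (t : I → k)
    (h : ∀ c, imageOn f (T ∩ t ⁻¹' {c}) = ⊥) : imageOn f T = ⊥ := by
  classical
  refine imageOn_eq_bot_of_lie f hA fun a b => ?_
  -- `Polynomial k` is infinite-dimensional, so some `p ≠ 0` has `p(t) • a` killed. On the zeros of
  -- `p ∘ t`, finitely many fibers suffice; elsewhere `⁅a, b⁆ = ⁅p(t) • a, p(t)⁻¹ • b⁆`.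
  let φ : Polynomial k →ₗ[k] B := ((f.comp (restrictTo k A T) : (∀ i, A i) →ₗ⁅k⁆ B) :
    (∀ i, A i) →ₗ[k] B) ∘ₗ polynomialSMul t a
  have hφ : LinearMap.ker φ ≠ ⊥ := fun hker => by
    have := Module.Finite.of_injective φ (LinearMap.ker_eq_bot.mp hker)
    exact Polynomial.not_finite this
  obtain ⟨p, hp, hp0⟩ := Submodule.exists_mem_ne_zero_of_ne_bot hφ
  have hp : f (restrictTo k A T (polynomialSMul t a p)) = 0 := hp
  let Z : Set I := {i | p.eval (t i) = 0}
  have hZ : imageOn f (T ∩ Z) = ⊥ := by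
    have := imageOn_biUnion_eq_bot f p.roots.toFinset (fun c => T ∩ t ⁻¹' {c}) fun c _ => h c
    rw [eq_bot_iff] at this ⊢
    refine (imageOn_mono f ?_).trans this
    rintro i ⟨hT, hi⟩
    simp only [Set.mem_iUnion]
    exact ⟨t i, Multiset.mem_toFinset.mpr ((Polynomial.mem_roots hp0).mpr hi), hT, rfl⟩
  let b' : ∀ i, A i := fun i => (p.eval (t i))⁻¹ • b i
  have hlie : ⁅polynomialSMul t a p, b'⁆ = restrictTo k A Zᶜ ⁅a, b⁆ := by
    ext i
    change ⁅p.eval (t i) • a i, (p.eval (t i))⁻¹ • b i⁆ = _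
    by_cases hi : p.eval (t i) = 0
    · rw [restrictTo_apply_of_notMem (Set.notMem_compl_iff.mpr (show i ∈ Z from hi)), hi,
        zero_smul, zero_lie]
    · rw [restrictTo_apply_of_mem (show i ∈ Zᶜ from hi), smul_lie, lie_smul, smul_smul,
        mul_inv_cancel₀ hi, one_smul]
      rfl
  rw [← LieHom.map_lie, ← LieHom.map_lie, restrictTo_eq_add T Z, map_add,
    (imageOn_eq_bot f).mp hZ, zero_add, ← restrictTo_restrictTo, ← hlie, LieHom.map_lie,
    LieHom.map_lie, hp, zero_lie]

include hA in
/-- If all factors of the product but not the whole product map to zero, then the index set carries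
a nonprincipal ultrafilter containing a fiber of every map to `k`. -/
theorem exists_ultrafilter_of_imageOn_ne_bot [FiniteDimensional k B] {S : Set I}
    (hS : imageOn f S ≠ ⊥) (h : ∀ i ∈ S, imageOn f {i} = ⊥) :
    ∃ U : Ultrafilter I, (∀ i, {i} ∉ U) ∧ ∀ t : I → k, ∃ c, t ⁻¹' {c} ∈ U := by
  obtain ⟨_, ⟨T, hTS, hT, rfl⟩, hmin⟩ := exists_minimal_of_wellFoundedLT (fun n => ∃ T ⊆ S,
    imageOn f T ≠ ⊥ ∧ Module.finrank k (imageOn f T) = n) ⟨_, S, subset_rfl, hS, rfl⟩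
  -- By minimality, a part of `T` with nonzero image has all of the image, so two complementary
  -- parts cannot both be nonzero.
  have hsub : ∀ X : Set I, imageOn f (T ∩ X) ≠ ⊥ → imageOn f (T ∩ X) = imageOn f T := by
    intro X hX
    have hle : imageOn f (T ∩ X) ≤ imageOn f T := imageOn_mono f Set.inter_subset_left
    exact Submodule.eq_of_le_of_finrank_le hle
      (hmin ⟨_, Set.inter_subset_left.trans hTS, hX, rfl⟩ (Submodule.finrank_mono hle))
  have hdisj : ∀ X : Set I, Disjoint (T ∩ X) (T ∩ Xᶜ) := fun X =>
    disjoint_compl_right.mono Set.inter_subset_right Set.inter_subset_right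
  have hcompl : ∀ X : Set I, imageOn f (T ∩ X) ≠ ⊥ → imageOn f (T ∩ Xᶜ) = ⊥ := by
    intro X hX
    by_contra hX'
    exact hX (imageOn_eq_bot_of_le_of_disjoint f hA ((hsub X hX).trans (hsub _ hX').symm).le
      (hdisj X))
  let F : Filter I :=
    { sets := {X | imageOn f (T ∩ Xᶜ) = ⊥}
      univ_sets := by simpa using imageOn_empty f
      sets_of_superset := fun {X Y} hX hXY => by
        rw [Set.mem_ofPred_eq, eq_bot_iff] at hX ⊢
        exact (imageOn_mono f (by gcongr)).trans hX
      inter_sets := fun {X Y} hX hY => by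
        rw [Set.mem_ofPred_eq] at hX hY ⊢
        rw [Set.compl_inter, Set.inter_union_distrib_left]
        exact imageOn_union_eq_bot f hX hY }
  have hF : ∀ X, X ∈ F ↔ imageOn f (T ∩ Xᶜ) = ⊥ := fun X => Iff.rfl
  have hmem : ∀ X : Set I, X ∈ F ↔ imageOn f (T ∩ X) ≠ ⊥ := by
    refine fun X => ⟨fun hX hX' => hT ?_, fun hX => hcompl X hX⟩
    rw [← Set.inter_union_compl T X]
    exact imageOn_union_eq_bot f hX' hX
  refine ⟨Ultrafilter.ofComplNotMemIff F fun X => ?_, fun i hi => ?_, fun t => ?_⟩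
  · rw [hmem, not_not, hF]
  · refine (hmem {i}).mp hi ?_
    by_cases hiT : i ∈ T
    · rw [Set.inter_eq_right.mpr (Set.singleton_subset_iff.mpr hiT)]
      exact h i (hTS hiT)
    · rw [Set.inter_singleton_eq_empty.mpr hiT]
      exact imageOn_empty f
  · by_contra! hc
    refine hT (imageOn_eq_bot_of_fibers f hA t fun c => ?_)
    by_contra hne
    exact hc c ((hmem _).mpr hne)

end Perfect

end Restriction

/-! ### Ideals and finite subproducts of simple factors -/

section Simple

variable {k : Type u} [Field k] {I : Type v} {A : I → Type w} [∀ i, LieRing (A i)]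
  [∀ i, LieAlgebra k (A i)]

theorem lie_single [DecidableEq I] (a : ∀ i, A i) (j : I) (c : A j) :
    ⁅a, (Pi.single j c : ∀ i, A i)⁆ = Pi.single j ⁅a j, c⁆ := by
  ext i
  change ⁅a i, (Pi.single j c : ∀ i, A i) i⁆ = _
  by_cases h : i = j
  · subst h; simp
  · simp [Pi.single_eq_of_ne h]

/-- An ideal of a product of Lie algebras that contains an element with a nonzero coordinate in a
simple factor contains this factor. -/
theorem single_mem_lieIdeal [DecidableEq I] {j : I} (hA : LieAlgebra.IsSimple k (A j))
    (K : LieIdeal k (∀ i, A i)) {a : ∀ i, A i} (ha : a ∈ K) (haj : a j ≠ 0) (c : A j) :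
    Pi.single j c ∈ K := by
  let N : LieIdeal k (A j) :=
    { K.toSubmodule.comap (LinearMap.single k A j) with
      lie_mem := fun {x c} hc => by
        change Pi.single j ⁅x, c⁆ ∈ K
        have : Pi.single j c ∈ K := hc
        rw [← Pi.single_eq_same (M := A) j x, ← lie_single]
        exact lie_mem_right k _ K _ _ this }
  have hN : ∀ c, c ∈ N ↔ Pi.single j c ∈ K := fun c => Iff.rfl
  -- If `N` were zero, `a j` would be central.
  have hlie : ∀ c, ⁅a j, c⁆ ∈ N := fun c => by
    rw [hN, ← lie_single]
    exact lie_mem_left k _ K _ _ ha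
  rcases hA.eq_bot_or_eq_top N with h | h
  · refine absurd ?_ haj
    have : a j ∈ LieAlgebra.center k (A j) := by
      intro c
      have := hlie c
      rw [h, LieSubmodule.mem_bot] at this
      rw [← lie_skew, this, neg_zero]
    rwa [LieAlgebra.center_eq_bot, LieSubmodule.mem_bot] at this
  · rw [← hN, h]
    exact LieSubmodule.mem_top c

theorem hasTrivialRadical_pi_of_isSimple (hA : ∀ i, LieAlgebra.IsSimple k (A i)) :
    LieAlgebra.HasTrivialRadical k (∀ i, A i) := by
  classical
  rw [LieAlgebra.hasTrivialRadical_iff_no_abelian_ideals]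
  intro K hK
  rw [LieSubmodule.eq_bot_iff]
  intro a ha
  ext j
  by_contra haj
  refine (hA j).non_abelian ⟨fun c d => ?_⟩
  have h := hK.trivial ⟨_, single_mem_lieIdeal (hA j) K ha haj c⟩
    ⟨_, single_mem_lieIdeal (hA j) K ha haj d⟩
  have h' : ⁅(Pi.single j c : ∀ i, A i), (Pi.single j d : ∀ i, A i)⁆ = 0 := congrArg Subtype.val h
  rwa [lie_single, Pi.single_eq_same, Pi.single_eq_zero_iff] at h'

theorem forall_exists_eq_lie_add_lie [IsAlgClosed k] [CharZero k]
    [∀ i, FiniteDimensional k (A i)] (hA : ∀ i, LieAlgebra.IsSimple k (A i)) (a : ∀ i, A i) :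
    ∃ x₁ x₂ y₁ y₂ : ∀ i, A i, a = ⁅x₁, y₁⁆ + ⁅x₂, y₂⁆ := by
  choose x₁ x₂ h using fun i =>
    have := hA i
    exists_pair_forall_eq_lie_add_lie k (A i)
  choose y₁ y₂ h using fun i => h i (a i)
  exact ⟨x₁, x₂, y₁, y₂, funext h⟩

open Classical in
/-- The extension by zero from a subproduct of Lie algebras to the product. -/
noncomputable def subproductIncl (k : Type u) [Field k] {I : Type v} (A : I → Type w)
    [∀ i, LieRing (A i)] [∀ i, LieAlgebra k (A i)] (s : Finset I) :
    (∀ i : s, A i) →ₗ⁅k⁆ (∀ i, A i) where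
  toFun a := fun i => if h : i ∈ s then a ⟨i, h⟩ else 0
  map_add' a b := by ext i; by_cases h : i ∈ s <;> simp [h]
  map_smul' t a := by ext i; by_cases h : i ∈ s <;> simp [h]
  map_lie' {a b} := by
    ext i
    change (if h : i ∈ s then (⁅(a ⟨i, h⟩ : A i), (b ⟨i, h⟩ : A i)⁆ : A i) else 0) =
      ⁅(if h : i ∈ s then a ⟨i, h⟩ else 0 : A i), (if h : i ∈ s then b ⟨i, h⟩ else 0 : A i)⁆
    by_cases h : i ∈ s <;> simp [h]

theorem subproductIncl_apply {s : Finset I} (a : ∀ i : s, A i) (i : s) :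
    subproductIncl k A s a i = a i := dif_pos i.2

theorem subproductIncl_subproductProj (s : Finset I) (a : ∀ i, A i) :
    subproductIncl k A s (subproductProj k A s a) = restrictTo k A s a := by
  ext i
  by_cases h : i ∈ s
  · rw [restrictTo_apply_of_mem (Finset.mem_coe.mpr h)]
    exact dif_pos h
  · rw [restrictTo_apply_of_notMem (mt Finset.mem_coe.mp h)]
    exact dif_neg h

variable {B : Type x} [LieRing B] [LieAlgebra k B]

/-- A surjective homomorphism from a product of simple Lie algebras that kills the elements with
support outside some finite set is, up to isomorphism, the projection onto a finite subproduct. -/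
theorem exists_lieEquiv_of_imageOn_compl_eq_bot (hA : ∀ i, LieAlgebra.IsSimple k (A i))
    (f : (∀ i, A i) →ₗ⁅k⁆ B) (hf : Function.Surjective f)
    (hJ : ∃ J : Finset I, imageOn f ((J : Set I)ᶜ) = ⊥) :
    ∃ (s : Finset I) (e : (∀ i : s, A i) ≃ₗ⁅k⁆ B),
      (∀ a, e a = f (subproductIncl k A s a)) ∧ f = e.toLieHom.comp (subproductProj k A s) := by
  classical
  obtain ⟨s, hs, hmin⟩ := exists_minimal_of_wellFoundedLT
    (fun J : Finset I => imageOn f ((J : Set I)ᶜ) = ⊥) hJ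
  have hfs : ∀ a, f (subproductIncl k A s (subproductProj k A s a)) = f a := by
    intro a
    conv_rhs => rw [← restrictTo_univ (k := k) a, restrictTo_eq_add Set.univ s, map_add,
      Set.univ_inter, Set.univ_inter, (imageOn_eq_bot f).mp hs, add_zero]
    rw [subproductIncl_subproductProj]
  -- A nonzero coordinate of a kernel element puts a whole factor in the kernel, so its index could
  -- be dropped from `s`.
  have hinj : Function.Injective (f.comp (subproductIncl k A s)) := by
    rw [injective_iff_map_eq_zero]
    intro a ha
    ext j
    by_contra haj
    have hker : subproductIncl k A s a ∈ f.ker := LieHom.mem_ker.mpr ha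
    have hsingle : ∀ c, Pi.single (j : I) c ∈ f.ker :=
      single_mem_lieIdeal (hA j) f.ker hker (by rwa [subproductIncl_apply])
    have hj : imageOn f {(j : I)} = ⊥ := by
      refine (imageOn_eq_bot f).mpr fun b => LieHom.mem_ker.mp ?_
      convert hsingle (b j)
      ext i
      by_cases h : i = j
      · subst h
        rw [restrictTo_apply_of_mem (Set.mem_singleton (j : I)), Pi.single_eq_same]
      · rw [restrictTo_apply_of_notMem (mt Set.mem_singleton_iff.mp h), Pi.single_eq_of_ne h]
    have herase : imageOn f (((s.erase j : Finset I) : Set I)ᶜ) = ⊥ := by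
      have := imageOn_union_eq_bot f hs hj
      rw [eq_bot_iff] at this ⊢
      refine (imageOn_mono f fun i hi => ?_).trans this
      by_cases h : i = j
      · exact Or.inr h
      · exact Or.inl fun his => hi (Finset.mem_coe.mpr (Finset.mem_erase.mpr ⟨h, his⟩))
    exact Finset.notMem_erase (j : I) s (hmin herase (Finset.erase_subset _ _) j.2)
  have hsurj : Function.Surjective (f.comp (subproductIncl k A s)) := fun b => by
    obtain ⟨a, rfl⟩ := hf b
    exact ⟨_, hfs a⟩
  exact ⟨s, LieEquiv.ofBijective _ ⟨hinj, hsurj⟩, fun _ => rfl, LieHom.ext fun a => (hfs a).symm⟩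

end Simple

theorem theorem5p1 {k : Type u} [Field k] [IsAlgClosed k] [CharZero k]
    {I : Type v} (A : I → Type w) [∀ i, LieRing (A i)] [∀ i, LieAlgebra k (A i)]
    [∀ i, FiniteDimensional k (A i)] (hA : ∀ i, LieAlgebra.IsSimple k (A i))
    (hI : ∀ μ : Cardinal.{max u v}, IsMeasurableCardinal μ →
      Cardinal.lift.{v} #k < μ → Cardinal.lift.{u} #I < μ)
    {B : Type x} [LieRing B] [LieAlgebra k B] [FiniteDimensional k B]
    (f : (∀ i, A i) →ₗ⁅k⁆ B) (hf : Function.Surjective f) :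
    LieAlgebra.IsSemisimple k B ∧
    (∃ (s : Finset I) (e : (∀ i : s, A i) ≃ₗ⁅k⁆ B),
      f = e.toLieHom.comp (subproductProj k A s)) ∧
    ∃ g : B →ₗ⁅k⁆ (∀ i, A i), f.comp g = LieHom.id := by
  have hperf := forall_exists_eq_lie_add_lie (k := k) hA
  obtain ⟨J, hJ⟩ := exists_finset_forall_imageOn_singleton_eq_bot f hperf
  have hJc : imageOn f ((J : Set I)ᶜ) = ⊥ := by
    by_contra hne
    obtain ⟨U, hU, hUk⟩ := exists_ultrafilter_of_imageOn_ne_bot f hperf hne hJ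
    obtain ⟨μ, hμ, hlt, hle⟩ := exists_isMeasurableCardinal_between U hU hUk
    exact (hI μ hμ hlt).not_ge hle
  obtain ⟨s, e, he, hfe⟩ := exists_lieEquiv_of_imageOn_compl_eq_bot hA f hf ⟨J, hJc⟩
  refine ⟨?_, ⟨s, e, hfe⟩, (subproductIncl k A s).comp e.symm.toLieHom, ?_⟩
  -- In characteristic zero a trivial radical makes the Killing form nondegenerate, a property that
  -- passes along `e`.
  · have := hasTrivialRadical_pi_of_isSimple (k := k) fun i : s => hA i
    have := e.isKilling
    infer_instance
  · ext b
    exact (he (e.symm b)).symm.trans (e.apply_symm_apply b)
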